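/- All Banach spaces are real, and $k$ is a positive integer or $\infty$. A $C^k$ bump function on a Banach space $X$ is a function $X\to\mathbb R$ of class $C^k$ (in the Fréchet sense) with bounded, non-empty support. For a set $L$, let $\ell_\infty(L)$ be the space of bounded real functions on $L$ and $c_0(L)$ its subspace of all $x$ such that $\{t\in L: |x_t|\ge\varepsilon\}$ is finite for every $\varepsilon>0$, both with the supremum norm $\|\cdot\|_\infty$. Let $U(L)$ be the set of all pairs $(f,x)\in\ell_\infty(L)\oplus c_0(L)$ such that $\|f\|_\infty$ and $\|x\|_\infty$ are both strictly less than $\big\||f|+\tfrac12|x|\big\|_\infty$. For a locally compact space $L$ and a Banach space $E$, let $C_0(L;E)$ be the Banach space of continuous functions $L\to E$ vanishing at infinity, with the supremum norm, and $C_0(L)=C_0(L;\mathbb R)$, regarded as a subspace of $\ell_\infty(L)$. A function $\phi:C_0(L)\to\mathbb R$ depends locally on finitely many coordinates if every $f^0\in C_0(L)$ has an open neighbourhood $G$ for which there is a finite set $M\subseteq L$ such that $\phi(f)=\phi(g)$ whenever $f,g\in G$ agree on $M$. Let $L$ be a locally compact space such that there exists a continuous map $T:C_0(L)\to c_0(L)$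 satisfying 1. for all $f\in C_0(L)$ the pair $(f,Tf)$ is in $U(L)\cup\{0\}$; 2. for each $t\in L$ the coordinate $f\mapsto (Tf)_t$ is a $C^k$ function on $C_0(L)$ depending locally on finitely many coordinates. Let $E$ be a Banach space admitting a $C^k$ bump function. Then the space $C_0(L;E)$ also admits a $C^k$ bump function. In particular, if each of the spaces $L_1,\dots,L_n$ is homeomorphic to an ordinal (with its order topology), then $C_0(L_1\times\dots\times L_n;E)$ admits a $C^k$ bump function whenever the Banach space $E$ does. -/

import Mathlib

open scoped ENNReal ZeroAtInfty
open Topology Filter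

universe u v w

/-- The real Banach space `ℓ_∞(L)` of bounded real functions on the set `L`, with the sup norm. -/
abbrev EllInfty (L : Type u) : Type u := lp (fun _ : L => ℝ) ∞

/-- The real Banach space `c₀(L)` on the set `L` (no topology on `L` is involved): the subspace of
`ℓ_∞(L)` of all `x` such that, for every `ε > 0`, one has `|x t| < ε` for all but finitely
many `t`. -/
def cZero (L : Type u) : Submodule ℝ (EllInfty L) where
  carrier := {x | Tendsto (fun t : L => x t) cofinite (𝓝 0)}
  add_mem' := by
    intro a b ha hb
    simpa using Tendsto.add ha hb
  zero_mem' := by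
    simpa using (tendsto_const_nhds : Tendsto (fun _ : L => (0 : ℝ)) cofinite (𝓝 0))
  smul_mem' := by
    intro c x hx
    simpa using Tendsto.const_mul c hx

/-- The sup norm of the bounded function `|f| + ½ |x|`. -/
noncomputable def supAbsAddHalfAbs {L : Type u} (f : EllInfty L) (x : cZero L) : ℝ :=
  ⨆ t : L, (|f t| + |x.1 t| / 2)

/-- The set `U(L)` of all pairs `(f, x)` in `ℓ_∞(L) ⊕ c₀(L)` such that `‖f‖` and `‖x‖` are both
strictly less than the sup norm of `|f| + ½ |x|`. -/
def talagrandSet (L : Type u) : Set (EllInfty L × cZero L) :=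
  {p | ‖p.1‖ < supAbsAddHalfAbs p.1 p.2 ∧ ‖p.2‖ < supAbsAddHalfAbs p.1 p.2}

/-- The inclusion of `C₀(L)` in `ℓ_∞(L)`. -/
def toEllInfty {L : Type u} [TopologicalSpace L] (f : C₀(L, ℝ)) : EllInfty L :=
  ⟨fun t => f t, memℓp_infty ⟨‖f.toBCF‖, by
    rintro _ ⟨t, rfl⟩
    exact f.toBCF.norm_coe_le_norm t⟩⟩

/-- A function on `C₀(L)` depends locally on finitely many coordinates. -/
def DependsLocallyOnFinitelyManyCoords {L : Type u} [TopologicalSpace L]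
    (φ : C₀(L, ℝ) → ℝ) : Prop :=
  ∀ f₀ : C₀(L, ℝ), ∃ G : Set C₀(L, ℝ), IsOpen G ∧ f₀ ∈ G ∧ ∃ M : Finset L,
    ∀ f ∈ G, ∀ g ∈ G, (∀ t ∈ M, f t = g t) → φ f = φ g

/-- `X` admits a bump function of class `C^k`: a `C^k` real function with bounded, non-empty
support. Here `k` is a natural number or `∞` (never analyticity). -/
def AdmitsBump (k : ℕ∞) (X : Type u) [NormedAddCommGroup X] [NormedSpace ℝ X] : Prop :=
  ∃ φ : X → ℝ, ContDiff ℝ k φ ∧ (Function.support φ).Nonempty ∧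
    Bornology.IsBounded (Function.support φ)

/-!
Normalise a bump function on `E` to `φ` with `φ 0 = 1`, and put `ρ = 1 - φ`. The map `f ↦ ρ ∘ f`
from `C₀(L, E)` to `C₀(L)` is continuous, and `‖ρ ∘ f‖ < 1` forces `f` to be bounded, so it is
enough to compose `f ↦ (ρ ∘ f, T (ρ ∘ f))` with a suitable cutoff of `{‖f‖ < 1}` on `U(L) ∪ {0}`.
That cutoff is the product over `t` of `ψ (f t, x t)`, where `ψ (u, v)` is `1` for small `v` and `0`
once `|u| + |v| / 2 > 1`. It is locally a finite product of functions of the coordinates: where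
`‖f‖ < 1`, all but finitely many factors are `1` because `x` is in `c₀(L)`; where `‖f‖ ≥ 1`, the
definition of `U(L)` provides a coordinate whose factor vanishes in a whole neighbourhood. The map
`f ↦ ρ ∘ f` need not be smooth, only its coordinates are; this is why the coordinates of `T` have to
depend locally on finitely many coordinates.

On an ordinal one takes `(T f) t = (f t - f (t + 1)) / 2`, which is in `c₀` because `f` has limits
along increasing sequences, and is nonzero at the last point where `|f|` is maximal. Products are
reduced to a single factor by currying.
-/

section ZeroAtInfty

section Composition

variable {L : Type u} [TopologicalSpace L] {E F : Type*} [PseudoMetricSpace E] [Zero E]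
  [PseudoMetricSpace F] [Zero F]

/-- Composition of a function vanishing at infinity with a continuous function fixing `0`, as the
map `C₀(L, E) → C₀(L, F)`. -/
def zeroAtInftyPostcomp (ρ : C(E, F)) (h0 : ρ 0 = 0) (f : C₀(L, E)) : C₀(L, F) where
  toFun t := ρ (f t)
  continuous_toFun := ρ.continuous.comp f.continuous
  zero_at_infty' := h0 ▸ (ρ.continuous.tendsto 0).comp f.zero_at_infty'

theorem continuous_zeroAtInftyPostcomp (ρ : C(E, F)) (h0 : ρ 0 = 0) :
    Continuous (zeroAtInftyPostcomp (L := L) ρ h0) := by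
  refine continuous_iff_continuousAt.2 fun f =>
    ZeroAtInftyContinuousMap.tendsto_iff_tendstoUniformly.2 fun r hr => ?_
  have hK : IsCompact (insert 0 (Set.range f)) :=
    f.zero_at_infty'.isCompact_insert_range_of_cocompact f.continuous
  filter_upwards [ZeroAtInftyContinuousMap.tendsto_iff_tendstoUniformly.1 (tendsto_id (x := 𝓝 f)) _
    (hK.uniformContinuousAt_of_continuousAt ρ (fun _ _ => ρ.continuous.continuousAt) hr)]
    with g hg t using hg t (Set.mem_insert_of_mem _ ⟨t, rfl⟩)

end Composition

section Norm

variable {L : Type u} [TopologicalSpace L] {E : Type*} [SeminormedAddCommGroup E]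

theorem norm_zeroAtInfty_apply_le (f : C₀(L, E)) (t : L) : ‖f t‖ ≤ ‖f‖ :=
  f.toBCF.norm_coe_le_norm t

theorem norm_zeroAtInfty_le {f : C₀(L, E)} {C : ℝ} (hC : 0 ≤ C) (h : ∀ t, ‖f t‖ ≤ C) : ‖f‖ ≤ C :=
  (BoundedContinuousFunction.norm_le (f := f.toBCF) hC).2 h

theorem eventually_cocompact_norm_zeroAtInfty_lt (f : C₀(L, E)) {ε : ℝ} (hε : 0 < ε) :
    ∀ᶠ t in cocompact L, ‖f t‖ < ε :=
  f.zero_at_infty'.norm.eventually_lt_const (by rwa [norm_zero])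

theorem isCompact_setOf_le_norm_zeroAtInfty (f : C₀(L, E)) {c : ℝ} (hc : 0 < c) :
    IsCompact {t | c ≤ ‖f t‖} := by
  obtain ⟨K, hK, hKf⟩ := mem_cocompact.1 (eventually_cocompact_norm_zeroAtInfty_lt f hc)
  refine hK.of_isClosed_subset (isClosed_le continuous_const f.continuous.norm) fun t ht => ?_
  by_contra htK
  have hlt : ‖f t‖ < c := hKf htK
  exact hlt.not_ge ht

theorem exists_norm_zeroAtInfty_apply_eq [Nonempty L] (f : C₀(L, E)) : ∃ t, ‖f t‖ = ‖f‖ := by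
  suffices h : ∃ t, ∀ s, ‖f s‖ ≤ ‖f t‖ from h.imp fun t ht =>
    (norm_zeroAtInfty_apply_le f t).antisymm (norm_zeroAtInfty_le (norm_nonneg _) ht)
  by_cases h : ∃ t, 0 < ‖f t‖
  · obtain ⟨t, ht⟩ := h
    exact f.continuous.norm.exists_forall_ge' t
      ((eventually_cocompact_norm_zeroAtInfty_lt f ht).mono fun _ => le_of_lt)
  · exact ⟨Classical.arbitrary L, fun s => (not_lt.1 fun hs => h ⟨s, hs⟩).trans (norm_nonneg _)⟩

variable (𝕜 : Type*) [NormedField 𝕜] [NormedSpace 𝕜 E]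

/-- Evaluation at a point, as a continuous linear map on `C₀(L, E)`. -/
noncomputable def zeroAtInftyEvalCLM (t : L) : C₀(L, E) →L[𝕜] E :=
  LinearMap.mkContinuous
    { toFun := fun f => f t, map_add' := fun _ _ => rfl, map_smul' := fun _ _ => rfl } 1
    fun f => (norm_zeroAtInfty_apply_le f t).trans_eq (one_mul _).symm

@[simp]
theorem zeroAtInftyEvalCLM_apply (t : L) (f : C₀(L, E)) : zeroAtInftyEvalCLM 𝕜 t f = f t := rfl

end Norm

end ZeroAtInfty

section LocalDependence

theorem exists_innerInverse_of_finiteDimensional {𝕜 V W : Type*} [NontriviallyNormedField 𝕜]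
    [CompleteSpace 𝕜] [AddCommGroup V] [Module 𝕜 V] [TopologicalSpace V] [IsTopologicalAddGroup V]
    [ContinuousSMul 𝕜 V] [AddCommGroup W] [Module 𝕜 W] [TopologicalSpace W]
    [IsTopologicalAddGroup W] [ContinuousSMul 𝕜 W] [T2Space W] [FiniteDimensional 𝕜 W]
    (r : V →ₗ[𝕜] W) : ∃ R : W →L[𝕜] V, ∀ x, r (R (r x)) = r x := by
  obtain ⟨g, hg⟩ := r.rangeRestrict.exists_rightInverse_of_surjective r.range_rangeRestrict
  obtain ⟨R, hR⟩ := g.exists_extend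
  refine ⟨LinearMap.toContinuousLinearMap R, fun x => ?_⟩
  calc r (R (r x)) = r (g (r.rangeRestrict x)) :=
        congrArg r (LinearMap.congr_fun hR (r.rangeRestrict x))
    _ = r x := congrArg Subtype.val (LinearMap.congr_fun hg (r.rangeRestrict x))

theorem DependsLocallyOnFinitelyManyCoords.contDiffAt_comp {L : Type u} [TopologicalSpace L]
    {X : Type*} [NormedAddCommGroup X] [NormedSpace ℝ X] {n : WithTop ℕ∞} {φ : C₀(L, ℝ) → ℝ}
    (hφ : DependsLocallyOnFinitelyManyCoords φ) {S : X → C₀(L, ℝ)} {x : X}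
    (hφS : ContDiffAt ℝ n φ (S x)) (hS : ContinuousAt S x)
    (hSt : ∀ t, ContDiffAt ℝ n (fun y => S y t) x) : ContDiffAt ℝ n (fun y => φ (S y)) x := by
  obtain ⟨G, hG, hxG, M, hM⟩ := hφ (S x)
  let r : C₀(L, ℝ) →L[ℝ] M → ℝ := .pi fun t => zeroAtInftyEvalCLM ℝ t.1
  obtain ⟨R, hR⟩ := exists_innerInverse_of_finiteDimensional (r : C₀(L, ℝ) →ₗ[ℝ] M → ℝ)
  -- `q y` agrees with `S y` on `M`, but only involves the coordinates of `S y` in `M`.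
  let q : X → C₀(L, ℝ) := fun y => S x + R (r (S y) - r (S x))
  have hqM : ∀ y, ∀ t ∈ M, S y t = q y t := fun y t ht => by
    have h : R (r (S y - S x)) t = (S y - S x) t := congrFun (hR (S y - S x)) ⟨t, ht⟩
    rw [map_sub, ZeroAtInftyContinuousMap.sub_apply] at h
    rw [ZeroAtInftyContinuousMap.add_apply, h, add_sub_cancel]
  have hqx : q x = S x := by simp only [q, sub_self, map_zero, add_zero]
  have hrS : ContDiffAt ℝ n (fun y => r (S y)) x := contDiffAt_pi.2 fun t => hSt t.1
  have hq : ContDiffAt ℝ n q x :=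
    contDiffAt_const.add (R.contDiff.contDiffAt.comp x (hrS.sub contDiffAt_const))
  refine (ContDiffAt.comp x (hqx.symm ▸ hφS) hq).congr_of_eventuallyEq ?_
  filter_upwards [hS.preimage_mem_nhds (hG.mem_nhds hxG),
    hq.continuousAt.preimage_mem_nhds (hG.mem_nhds (hqx.symm ▸ hxG))] with y hSy hqy
  exact hM _ hSy _ hqy (hqM y)

end LocalDependence

section CoordCutoff

/-- The factor of the cutoff on `ℓ_∞(L) ⊕ c₀(L)` that belongs to one coordinate: on
`(-1, 1) × ℝ` it is smooth, `1` where `|v|` is small and `0` where `|u| + |v| / 2 > 1`. Here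
`1 - u ^ 2` is a smooth substitute for `1 - |u|`: it lies between `1 - |u|` and `2 * (1 - |u|)`. -/
noncomputable def coordCutoff (p : ℝ × ℝ) : ℝ :=
  1 - Real.smoothTransition (2 * (p.2 / (1 - p.1 ^ 2)) ^ 2 - 1)

theorem contDiffAt_coordCutoff {n : ℕ∞} {p : ℝ × ℝ} (hp : |p.1| < 1) :
    ContDiffAt ℝ n coordCutoff p := by
  have h : 1 - p.1 ^ 2 ≠ 0 := (sub_pos.2 ((sq_lt_one_iff_abs_lt_one _).2 hp)).ne'
  exact contDiffAt_const.sub (Real.smoothTransition.contDiff.contDiffAt.comp p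
    ((contDiffAt_const.mul
      ((contDiffAt_snd.div (contDiffAt_const.sub (contDiffAt_fst.pow 2)) h).pow 2)).sub
        contDiffAt_const))

theorem coordCutoff_eq_one {u v c : ℝ} (hc : c < 1) (hu : |u| ≤ c)
    (hv : |v| ≤ (1 - c ^ 2) / 2) : coordCutoff (u, v) = 1 := by
  have hu2 : u ^ 2 ≤ c ^ 2 := sq_le_sq.2 (hu.trans (le_abs_self c))
  have hpos : 0 < 1 - u ^ 2 := sub_pos.2 ((sq_lt_one_iff_abs_lt_one _).2 (hu.trans_lt hc))
  have hquot : |v / (1 - u ^ 2)| ≤ |1 / 2| := by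
    rw [abs_div, abs_of_pos hpos, div_le_iff₀ hpos, abs_of_pos (one_half_pos (α := ℝ))]
    linarith
  rw [coordCutoff, Real.smoothTransition.zero_of_nonpos (by linarith [sq_le_sq.2 hquot]), sub_zero]

theorem coordCutoff_eq_zero {u v : ℝ} (hu : |u| < 1) (h : 1 < |u| + |v| / 2) :
    coordCutoff (u, v) = 0 := by
  have hpos : 0 < 1 - u ^ 2 := sub_pos.2 ((sq_lt_one_iff_abs_lt_one _).2 hu)
  have hquot : |(1 : ℝ)| ≤ |v / (1 - u ^ 2)| := by
    rw [abs_one, abs_div, abs_of_pos hpos, le_div_iff₀ hpos, ← sq_abs u]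
    nlinarith [abs_nonneg u]
  rw [coordCutoff, Real.smoothTransition.one_of_one_le (by linarith [sq_le_sq.2 hquot]), sub_self]

end CoordCutoff

section TalagrandCutoff

variable {L : Type u}

theorem exists_lt_of_lt_supAbsAddHalfAbs {f : EllInfty L} {x : cZero L} {c : ℝ} (hc : 0 ≤ c)
    (h : c < supAbsAddHalfAbs f x) : ∃ t, c < |f t| + |x.1 t| / 2 := by
  by_contra! hle
  exact h.not_ge (Real.iSup_le hle hc)

theorem le_supAbsAddHalfAbs (f : EllInfty L) (x : cZero L) (t : L) :
    |f t| + |x.1 t| / 2 ≤ supAbsAddHalfAbs f x := by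
  refine le_ciSup (f := fun t : L => |f t| + |x.1 t| / 2) ⟨‖f‖ + ‖x.1‖ / 2, ?_⟩ t
  rintro _ ⟨s, rfl⟩
  exact add_le_add (lp.norm_apply_le_norm ENNReal.top_ne_zero f s)
    (div_le_div_of_nonneg_right (lp.norm_apply_le_norm ENNReal.top_ne_zero x.1 s) zero_le_two)

theorem zero_prodMk_notMem_talagrandSet (x : cZero L) : ((0 : EllInfty L), x) ∉ talagrandSet L := by
  rintro ⟨-, h⟩
  obtain ⟨t, ht⟩ := exists_lt_of_lt_supAbsAddHalfAbs (norm_nonneg x) h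
  have hx : |x.1 t| ≤ ‖x‖ := lp.norm_apply_le_norm ENNReal.top_ne_zero x.1 t
  have hzero : |(0 : EllInfty L) t| = 0 := abs_zero
  linarith [abs_nonneg (x.1 t)]

theorem exists_finset_eventually_abs_lt (x : cZero L) {ε : ℝ} (hε : 0 < ε) :
    ∃ M : Finset L, ∀ᶠ y in 𝓝 x, ∀ t ∉ M, |y.1 t| < ε := by
  have hfin : {t | ¬ |x.1 t| < ε / 2}.Finite :=
    x.2.abs.eventually_lt_const (by rw [abs_zero]; exact half_pos hε)
  refine ⟨hfin.toFinset, ?_⟩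
  filter_upwards [Metric.ball_mem_nhds x (half_pos hε)] with y hy t ht
  have hxt : |x.1 t| < ε / 2 := by simpa using ht
  have hyx : |y.1 t - x.1 t| < ε / 2 :=
    (lp.norm_apply_le_norm ENNReal.top_ne_zero (y - x).1 t).trans_lt (mem_ball_iff_norm.1 hy)
  linarith [abs_sub_abs_le_abs_sub (y.1 t) (x.1 t)]

/-- A cutoff function of the set `{‖f‖ < 1}` on `ℓ_∞(L) ⊕ c₀(L)`, which along `U(L) ∪ {0}` is
locally a finite product of smooth functions of the coordinates. -/
noncomputable def talagrandCutoff (p : EllInfty L × cZero L) : ℝ :=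
  if ‖p.1‖ < 1 then ∏ᶠ t, coordCutoff (p.1 t, p.2.1 t) else 0

theorem norm_fst_lt_one_of_talagrandCutoff_ne_zero {p : EllInfty L × cZero L}
    (h : talagrandCutoff p ≠ 0) : ‖p.1‖ < 1 := by
  by_contra hp
  exact h (if_neg hp)

theorem talagrandCutoff_zero : talagrandCutoff (0 : EllInfty L × cZero L) = 1 := by
  have h (t : L) :
      coordCutoff ((0 : EllInfty L × cZero L).1 t, (0 : EllInfty L × cZero L).2.1 t) = 1 :=
    coordCutoff_eq_one (c := 0) one_pos (by simp) (by simp)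
  rw [talagrandCutoff, Prod.fst_zero, norm_zero, if_pos one_pos]
  exact (finprod_congr h).trans finprod_one

theorem exists_finset_eventually_coordCutoff_eq_one {p : EllInfty L × cZero L} (hp : ‖p.1‖ < 1) :
    ∃ M : Finset L, ∀ᶠ q in 𝓝 p, ∀ t ∉ M, coordCutoff (q.1 t, q.2.1 t) = 1 := by
  obtain ⟨c, hpc, hc⟩ := exists_between hp
  have hc2 : 0 < 1 - c ^ 2 := by nlinarith [norm_nonneg p.1]
  obtain ⟨M, hM⟩ := exists_finset_eventually_abs_lt p.2 (half_pos hc2)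
  refine ⟨M, ?_⟩
  filter_upwards [continuous_fst.norm.continuousAt.eventually_lt_const hpc,
    continuous_snd.continuousAt.eventually hM] with q hq1 hq2 t ht
  exact coordCutoff_eq_one hc
    ((lp.norm_apply_le_norm ENNReal.top_ne_zero q.1 t).trans hq1.le) (hq2 t ht).le

theorem exists_finset_talagrandCutoff_eventuallyEq_prod {p : EllInfty L × cZero L}
    (hp : ‖p.1‖ < 1) :
    ∃ M : Finset L, talagrandCutoff =ᶠ[𝓝 p] fun q => ∏ t ∈ M, coordCutoff (q.1 t, q.2.1 t) := by
  obtain ⟨M, hM⟩ := exists_finset_eventually_coordCutoff_eq_one hp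
  refine ⟨M, ?_⟩
  filter_upwards [hM, continuous_fst.norm.continuousAt.eventually_lt_const hp] with q hqM hq
  rw [talagrandCutoff, if_pos hq]
  exact finprod_eq_prod_of_mulSupport_subset _ fun t ht => not_not.1 fun htM => ht (hqM t htM)

theorem talagrandCutoff_eq_zero {p : EllInfty L × cZero L} {t : L}
    (ht : 1 < |p.1 t| + |p.2.1 t| / 2) : talagrandCutoff p = 0 := by
  by_cases hp : ‖p.1‖ < 1
  · obtain ⟨M, hM⟩ := exists_finset_eventually_coordCutoff_eq_one hp
    have hzero : coordCutoff (p.1 t, p.2.1 t) = 0 :=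
      coordCutoff_eq_zero ((lp.norm_apply_le_norm ENNReal.top_ne_zero p.1 t).trans_lt hp) ht
    rw [talagrandCutoff, if_pos hp]
    exact finprod_eq_zero _ t hzero
      (M.finite_toSet.subset fun s hs => not_not.1 fun hsM => hs (hM.self_of_nhds s hsM))
  · exact if_neg hp

theorem talagrandCutoff_eventuallyEq_zero {p : EllInfty L × cZero L} (hU : p ∈ talagrandSet L)
    (hp : 1 ≤ ‖p.1‖) : talagrandCutoff =ᶠ[𝓝 p] 0 := by
  obtain ⟨t, ht⟩ := exists_lt_of_lt_supAbsAddHalfAbs (norm_nonneg _) hU.1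
  have hcont : Continuous fun q : EllInfty L × cZero L => |q.1 t| + |q.2.1 t| / 2 :=
    ((lp.evalCLM ℝ (fun _ : L => ℝ) ∞ t).continuous.comp continuous_fst).abs.add
      (((lp.evalCLM ℝ (fun _ : L => ℝ) ∞ t).continuous.comp
        (continuous_subtype_val.comp continuous_snd)).abs.div_const 2)
  filter_upwards [hcont.continuousAt.eventually_const_lt (hp.trans_lt ht)] with q hq
  exact talagrandCutoff_eq_zero hq

theorem contDiffAt_talagrandCutoff_comp {X : Type*} [NormedAddCommGroup X] [NormedSpace ℝ X]
    {k : ℕ∞} {F : X → EllInfty L × cZero L} {x : X} (hF : ContinuousAt F x)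
    (hF₁ : ∀ t, ContDiffAt ℝ k (fun y => (F y).1 t) x)
    (hF₂ : ∀ t, ContDiffAt ℝ k (fun y => (F y).2.1 t) x) (hU : F x ∈ talagrandSet L ∪ {0}) :
    ContDiffAt ℝ k (fun y => talagrandCutoff (F y)) x := by
  by_cases hx : ‖(F x).1‖ < 1
  · obtain ⟨M, hM⟩ := exists_finset_talagrandCutoff_eventuallyEq_prod hx
    have hprod : ContDiffAt ℝ k (fun y => ∏ t ∈ M, coordCutoff ((F y).1 t, (F y).2.1 t)) x :=
      contDiffAt_prod fun t _ => (contDiffAt_coordCutoff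
        ((lp.norm_apply_le_norm ENNReal.top_ne_zero (F x).1 t).trans_lt hx)).comp x
          ((hF₁ t).prodMk (hF₂ t))
    exact hprod.congr_of_eventuallyEq (hF.eventually hM)
  · have hUx : F x ∈ talagrandSet L := hU.resolve_right fun h0 => hx <| by
      rw [Set.mem_singleton_iff.1 h0, Prod.fst_zero, norm_zero]
      exact one_pos
    exact contDiffAt_const.congr_of_eventuallyEq
      (hF.eventually (talagrandCutoff_eventuallyEq_zero hUx (not_lt.1 hx)))

end TalagrandCutoff

section Bump

theorem AdmitsBump.exists_apply_zero_eq_one {k : ℕ∞} {X : Type u} [NormedAddCommGroup X]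
    [NormedSpace ℝ X] (h : AdmitsBump k X) :
    ∃ φ : X → ℝ, ContDiff ℝ k φ ∧ φ 0 = 1 ∧ Bornology.IsBounded (Function.support φ) := by
  obtain ⟨φ, hφ, ⟨x₀, hx₀⟩, hb⟩ := h
  refine ⟨fun x => φ (x + x₀) / φ x₀, (hφ.comp (contDiff_id.add contDiff_const)).div_const _,
    by simpa using div_self hx₀, ?_⟩
  refine ((isometry_add_right x₀).antilipschitz.isBounded_preimage hb).subset fun x hx => ?_
  exact left_ne_zero_of_mul hx

theorem AdmitsBump.of_antilipschitz {k : ℕ∞} {X : Type u} {Y : Type v} [NormedAddCommGroup X]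
    [NormedSpace ℝ X] [NormedAddCommGroup Y] [NormedSpace ℝ Y] (h : AdmitsBump k Y)
    (J : X →L[ℝ] Y) {K : NNReal} (hJ : AntilipschitzWith K J) : AdmitsBump k X := by
  obtain ⟨φ, hφ, h0, hb⟩ := h.exists_apply_zero_eq_one
  exact ⟨φ ∘ J, hφ.comp J.contDiff, ⟨0, by simp [h0]⟩, hJ.isBounded_preimage hb⟩

end Bump

section TalagrandOperator

variable {L : Type u} [TopologicalSpace L]

theorem norm_toEllInfty (f : C₀(L, ℝ)) : ‖toEllInfty f‖ = ‖f‖ :=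
  le_antisymm
    (lp.norm_le_of_forall_le (norm_nonneg f) fun t => norm_zeroAtInfty_apply_le f t)
    (norm_zeroAtInfty_le (norm_nonneg _)
      fun t => lp.norm_apply_le_norm ENNReal.top_ne_zero (toEllInfty f) t)

theorem isometry_toEllInfty : Isometry (toEllInfty (L := L)) :=
  Isometry.of_dist_eq fun f g => by
    rw [dist_eq_norm, dist_eq_norm, ← norm_toEllInfty (f - g)]
    rfl

/-- A (generally nonlinear) Talagrand operator of class `C^k` for `L`: a continuous map
`T : C₀(L) → c₀(L)` whose graph lies in `U(L) ∪ {0}` and whose coordinates are `C^k` functions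
depending locally on finitely many coordinates. -/
structure IsTalagrandOperator (k : ℕ∞) (T : C₀(L, ℝ) → cZero L) : Prop where
  continuous : Continuous T
  mem_talagrandSet : ∀ f, (toEllInfty f, T f) ∈ talagrandSet L ∪ {0}
  contDiff_coord : ∀ t, ContDiff ℝ k fun f => (T f).1 t
  dependsLocally_coord : ∀ t, DependsLocallyOnFinitelyManyCoords fun f => (T f).1 t

theorem IsTalagrandOperator.map_zero {k : ℕ∞} {T : C₀(L, ℝ) → cZero L}
    (hT : IsTalagrandOperator k T) : T 0 = 0 :=
  congrArg Prod.snd ((hT.mem_talagrandSet 0).resolve_left (zero_prodMk_notMem_talagrandSet (T 0)))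

theorem IsTalagrandOperator.admitsBump_zeroAtInfty {k : ℕ∞} {T : C₀(L, ℝ) → cZero L}
    (hT : IsTalagrandOperator k T) {E : Type w} [NormedAddCommGroup E] [NormedSpace ℝ E]
    (hE : AdmitsBump k E) : AdmitsBump k C₀(L, E) := by
  obtain ⟨φ, hφ, hφ0, hb⟩ := hE.exists_apply_zero_eq_one
  obtain ⟨R, hR⟩ := hb.exists_norm_le
  have hρ : ContDiff ℝ k fun e => 1 - φ e := contDiff_const.sub hφ
  have hρ0 : 1 - φ 0 = 0 := by rw [hφ0, sub_self]
  let S : C₀(L, E) → C₀(L, ℝ) := zeroAtInftyPostcomp ⟨fun e => 1 - φ e, hρ.continuous⟩ hρ0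
  have hS : Continuous S := continuous_zeroAtInftyPostcomp _ _
  have hSt (t : L) : ContDiff ℝ k fun f => S f t :=
    hρ.comp (zeroAtInftyEvalCLM ℝ t : C₀(L, E) →L[ℝ] E).contDiff
  have hTSt (t : L) (f : C₀(L, E)) : ContDiffAt ℝ k (fun f => (T (S f)).1 t) f :=
    (hT.dependsLocally_coord t).contDiffAt_comp (hT.contDiff_coord t).contDiffAt hS.continuousAt
      fun s => (hSt s).contDiffAt
  have hF : Continuous fun f => (toEllInfty (S f), T (S f)) :=
    (isometry_toEllInfty.continuous.comp hS).prodMk (hT.continuous.comp hS)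
  refine ⟨fun f => talagrandCutoff (toEllInfty (S f), T (S f)), ?_, ⟨0, ?_⟩, ?_⟩
  · exact contDiff_iff_contDiffAt.2 fun f => contDiffAt_talagrandCutoff_comp hF.continuousAt
      (fun t => (hSt t).contDiffAt) (fun t => hTSt t f) (hT.mem_talagrandSet (S f))
  · have hS0 : S 0 = 0 := ZeroAtInftyContinuousMap.ext fun _ => hρ0
    have hF0 : (toEllInfty (S 0), T (S 0)) = 0 := by
      rw [hS0, hT.map_zero]
      rfl
    rw [Function.mem_support, hF0, talagrandCutoff_zero]
    exact one_ne_zero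
  · refine isBounded_iff_forall_norm_le.2 ⟨R, fun f hf => ?_⟩
    have hlt : ‖S f‖ < 1 := norm_toEllInfty (S f) ▸ norm_fst_lt_one_of_talagrandCutoff_ne_zero hf
    have hR0 : 0 ≤ R := (norm_nonneg 0).trans (hR 0 (hφ0.trans_ne one_ne_zero))
    refine norm_zeroAtInfty_le hR0 fun t => hR _ fun hzero => hlt.not_ge ?_
    calc 1 = ‖S f t‖ := by rw [show S f t = 1 - φ (f t) from rfl, hzero, sub_zero, norm_one]
      _ ≤ ‖S f‖ := norm_zeroAtInfty_apply_le _ t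

end TalagrandOperator

section WellOrder

/-- The operator into `c₀(L)` with given continuous linear coordinates. -/
noncomputable def cZero.ofCoords {L : Type u} {X : Type*} [SeminormedAddCommGroup X]
    [NormedSpace ℝ X] (φ : L → X →L[ℝ] ℝ) {C : NNReal} (hC : ∀ t x, ‖φ t x‖ ≤ C * ‖x‖)
    (h0 : ∀ x, Tendsto (fun t => φ t x) cofinite (𝓝 0)) : X →L[ℝ] cZero L :=
  LinearMap.mkContinuous
    { toFun := fun x => ⟨⟨fun t => φ t x, memℓp_infty ⟨C * ‖x‖, by
        rintro _ ⟨t, rfl⟩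
        exact hC t x⟩⟩, h0 x⟩
      map_add' := fun x y => Subtype.ext (lp.ext (funext fun t => map_add (φ t) x y))
      map_smul' := fun c x => Subtype.ext (lp.ext (funext fun t => map_smul (φ t) c x)) } C
    fun x => lp.norm_le_of_forall_le (by positivity) fun t => hC t x

theorem exists_strictMono_forall_mem_of_infinite {α : Type*} [LinearOrder α] [WellFoundedLT α]
    {s : Set α} (hs : s.Infinite) : ∃ a : ℕ → α, StrictMono a ∧ ∀ n, a n ∈ s := by
  have := hs.to_subtype
  let e : ℕ ↪ s := Infinite.natEmbedding s
  obtain ⟨g, hg⟩ := wellQuasiOrdered_le.exists_monotone_subseq fun n => (e n : α)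
  have hinj : Function.Injective fun n => (e (g n) : α) :=
    Subtype.val_injective.comp (e.injective.comp g.injective)
  exact ⟨_, Monotone.strictMono_of_injective (fun m n => hg m n) hinj, fun n => (e (g n)).2⟩

section Interlacing

variable {L : Type u} [LinearOrder L] [WellFoundedLT L] [TopologicalSpace L] [OrderTopology L]

theorem tendsto_atTop_or_exists_tendsto_nhds_of_monotone {ι : Type*} [Preorder ι] [Nonempty ι]
    {a : ι → L} (ha : Monotone a) : Tendsto a atTop atTop ∨ ∃ l, Tendsto a atTop (𝓝 l) := by
  have : Nonempty L := ‹Nonempty ι›.map a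
  let := WellFoundedLT.toOrderBot L
  let := WellFoundedLT.conditionallyCompleteLinearOrderBot L
  exact tendsto_atTop_of_monotone ha

theorem tendsto_zeroAtInfty_sub_of_interlacing {E : Type*} [SeminormedAddCommGroup E]
    (f : C₀(L, E)) {a b : ℕ → L} (ha : StrictMono a) (hab : ∀ n, a n ≤ b n)
    (hba : ∀ n, b n ≤ a (n + 1)) : Tendsto (fun n => f (a n) - f (b n)) atTop (𝓝 0) := by
  suffices h : ∃ c, Tendsto (f ∘ a) atTop (𝓝 c) ∧ Tendsto (f ∘ b) atTop (𝓝 c) by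
    obtain ⟨c, hfa, hfb⟩ := h
    simpa only [sub_self, Function.comp_apply] using hfa.sub hfb
  rcases tendsto_atTop_or_exists_tendsto_nhds_of_monotone ha.monotone with htop | ⟨l, hl⟩
  · have : Nonempty L := ⟨a 0⟩
    have : NoMaxOrder L := ⟨fun s => (htop.eventually_ge_atTop s).exists.elim fun n hn =>
      ⟨a (n + 1), hn.trans_lt (ha n.lt_succ_self)⟩⟩
    have hf : Tendsto f atTop (𝓝 0) := f.zero_at_infty'.mono_left atTop_le_cocompact
    exact ⟨0, hf.comp htop, hf.comp (tendsto_atTop_mono hab htop)⟩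
  · have hb : Tendsto b atTop (𝓝 l) :=
      tendsto_of_tendsto_of_tendsto_of_le_of_le hl (hl.comp (tendsto_add_atTop_nat 1)) hab hba
    exact ⟨f l, (f.continuous.tendsto l).comp hl, (f.continuous.tendsto l).comp hb⟩

end Interlacing

variable {L : Type u} [LinearOrder L] [SuccOrder L] [TopologicalSpace L]

section SuccEval

variable {E : Type*} [SeminormedAddCommGroup E] (𝕜 : Type*) [NormedField 𝕜] [NormedSpace 𝕜 E]

open scoped Classical in
/-- The value of a function at the successor of `t`, as a continuous linear map on `C₀(L, E)`. If
`t` is maximal its successor is the point at infinity, where all functions vanish (whereas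
`Order.succ t = t`). -/
noncomputable def succEvalCLM (t : L) : C₀(L, E) →L[𝕜] E :=
  if IsMax t then 0 else zeroAtInftyEvalCLM 𝕜 (Order.succ t)

theorem succEvalCLM_of_isMax {t : L} (ht : IsMax t) (f : C₀(L, E)) : succEvalCLM 𝕜 t f = 0 := by
  rw [succEvalCLM, if_pos ht, zero_apply]

theorem succEvalCLM_of_not_isMax {t : L} (ht : ¬ IsMax t) (f : C₀(L, E)) :
    succEvalCLM 𝕜 t f = f (Order.succ t) := by
  rw [succEvalCLM, if_neg ht, zeroAtInftyEvalCLM_apply]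

theorem norm_succEvalCLM_apply_le (t : L) (f : C₀(L, E)) : ‖succEvalCLM 𝕜 t f‖ ≤ ‖f‖ := by
  by_cases ht : IsMax t
  · rw [succEvalCLM_of_isMax 𝕜 ht, norm_zero]
    exact norm_nonneg f
  · rw [succEvalCLM_of_not_isMax 𝕜 ht]
    exact norm_zeroAtInfty_apply_le f _

theorem exists_norm_apply_eq_and_norm_succEvalCLM_lt [ClosedIciTopology L] {f : C₀(L, E)}
    (hf : 0 < ‖f‖) : ∃ t, ‖f t‖ = ‖f‖ ∧ ‖succEvalCLM 𝕜 t f‖ < ‖f‖ := by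
  have : Nonempty L := by
    by_contra h
    have := not_nonempty_iff.1 h
    exact hf.not_ge (norm_zeroAtInfty_le le_rfl isEmptyElim)
  obtain ⟨t, ht, hmax⟩ := (isCompact_setOf_le_norm_zeroAtInfty f hf).exists_isGreatest
    ((exists_norm_zeroAtInfty_apply_eq f).imp fun _ => ge_of_eq)
  refine ⟨t, (norm_zeroAtInfty_apply_le f t).antisymm ht, ?_⟩
  by_cases hm : IsMax t
  · rwa [succEvalCLM_of_isMax 𝕜 hm, norm_zero]
  · rw [succEvalCLM_of_not_isMax 𝕜 hm]
    exact lt_of_not_ge fun h => (Order.lt_succ_of_not_isMax hm).not_ge (hmax h)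

variable [WellFoundedLT L] [OrderTopology L]

theorem tendsto_sub_succEvalCLM_cofinite (f : C₀(L, E)) :
    Tendsto (fun t => f t - succEvalCLM 𝕜 t f) cofinite (𝓝 0) := by
  refine Metric.tendsto_nhds.2 fun ε hε => ?_
  by_contra hinf
  obtain ⟨a, ha, hmem⟩ := exists_strictMono_forall_mem_of_infinite hinf
  have hlim := tendsto_zeroAtInfty_sub_of_interlacing f ha (fun n => Order.le_succ (a n))
    fun n => Order.succ_le_of_lt (ha n.lt_succ_self)
  obtain ⟨n, hn⟩ := (Metric.tendsto_nhds.1 hlim ε hε).exists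
  refine hmem n ?_
  rw [← succEvalCLM_of_not_isMax 𝕜 (not_isMax_of_lt (ha n.lt_succ_self))] at hn
  exact hn

end SuccEval

/-- The coordinates `f ↦ (f t - f (t + 1)) / 2` of the Talagrand operator of a well-order. -/
noncomputable def halfSuccDiffCLM (t : L) : C₀(L, ℝ) →L[ℝ] ℝ :=
  (2⁻¹ : ℝ) • (zeroAtInftyEvalCLM ℝ t - succEvalCLM ℝ t)

theorem halfSuccDiffCLM_apply (t : L) (f : C₀(L, ℝ)) :
    halfSuccDiffCLM t f = 2⁻¹ * (f t - succEvalCLM ℝ t f) := rfl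

theorem norm_halfSuccDiffCLM_apply_le (t : L) (f : C₀(L, ℝ)) : ‖halfSuccDiffCLM t f‖ ≤ ‖f‖ := by
  have h : ‖f t - succEvalCLM ℝ t f‖ ≤ ‖f‖ + ‖f‖ :=
    norm_sub_le_of_le (norm_zeroAtInfty_apply_le f t) (norm_succEvalCLM_apply_le ℝ t f)
  rw [halfSuccDiffCLM_apply, norm_mul, norm_inv, Real.norm_two]
  linarith

variable [WellFoundedLT L] [OrderTopology L]

/-- The Talagrand operator `f ↦ (f t - f (t + 1)) / 2` of a well-order `L`. -/
noncomputable def succDiff : C₀(L, ℝ) →L[ℝ] cZero L :=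
  cZero.ofCoords halfSuccDiffCLM (C := 1)
    (fun t f => (norm_halfSuccDiffCLM_apply_le t f).trans_eq (one_mul _).symm) fun f => by
      simpa only [halfSuccDiffCLM_apply, mul_zero] using
        (tendsto_sub_succEvalCLM_cofinite ℝ f).const_mul (2⁻¹ : ℝ)

theorem succDiff_apply (f : C₀(L, ℝ)) (t : L) : (succDiff f).1 t = halfSuccDiffCLM t f := rfl

theorem norm_succDiff_le (f : C₀(L, ℝ)) : ‖succDiff f‖ ≤ ‖f‖ :=
  lp.norm_le_of_forall_le (norm_nonneg f) fun t => norm_halfSuccDiffCLM_apply_le t f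

theorem succDiff_mem_talagrandSet {f : C₀(L, ℝ)} (hf : f ≠ 0) :
    (toEllInfty f, succDiff f) ∈ talagrandSet L := by
  obtain ⟨t, ht, hlt⟩ := exists_norm_apply_eq_and_norm_succEvalCLM_lt ℝ (norm_pos_iff.2 hf)
  have hne : f t - succEvalCLM ℝ t f ≠ 0 := fun h =>
    hlt.ne (by rw [← sub_eq_zero.1 h, ht])
  have hpos : 0 < |(succDiff f).1 t| := abs_pos.2 (mul_ne_zero (inv_ne_zero two_ne_zero) hne)
  have hsup : ‖f‖ < supAbsAddHalfAbs (toEllInfty f) (succDiff f) :=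
    calc ‖f‖ = |toEllInfty f t| := ht.symm
      _ < |toEllInfty f t| + |(succDiff f).1 t| / 2 := by linarith
      _ ≤ supAbsAddHalfAbs (toEllInfty f) (succDiff f) := le_supAbsAddHalfAbs _ _ t
  exact ⟨(norm_toEllInfty f).trans_lt hsup, (norm_succDiff_le f).trans_lt hsup⟩

theorem dependsLocallyOnFinitelyManyCoords_succDiff (t : L) :
    DependsLocallyOnFinitelyManyCoords fun f : C₀(L, ℝ) => (succDiff f).1 t := by
  refine fun _ => ⟨Set.univ, isOpen_univ, trivial, {t, Order.succ t}, fun f _ g _ h => ?_⟩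
  have hsucc : succEvalCLM ℝ t f = succEvalCLM ℝ t g := by
    by_cases ht : IsMax t
    · rw [succEvalCLM_of_isMax ℝ ht, succEvalCLM_of_isMax ℝ ht]
    · rw [succEvalCLM_of_not_isMax ℝ ht, succEvalCLM_of_not_isMax ℝ ht, h _ (by simp)]
  simp only [succDiff_apply, halfSuccDiffCLM_apply, hsucc, h t (by simp)]

theorem isTalagrandOperator_succDiff (k : ℕ∞) :
    IsTalagrandOperator k (succDiff : C₀(L, ℝ) → cZero L) where
  continuous := succDiff.continuous
  mem_talagrandSet f := by
    rcases eq_or_ne f 0 with rfl | hf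
    · exact Or.inr (by rw [map_zero]; rfl)
    · exact Or.inl (succDiff_mem_talagrandSet hf)
  contDiff_coord t := (halfSuccDiffCLM t).contDiff
  dependsLocally_coord := dependsLocallyOnFinitelyManyCoords_succDiff

end WellOrder

section Product

variable {A : Type u} {B : Type v} [TopologicalSpace A] [TopologicalSpace B]

section Curry

variable {E : Type*} [SeminormedAddCommGroup E]

/-- The section `b ↦ f (a, b)` of a function vanishing at infinity on a product. -/
def zeroAtInftySection (f : C₀(A × B, E)) (a : A) : C₀(B, E) where
  toFun b := f (a, b)
  continuous_toFun := f.continuous.comp (Continuous.prodMk_right a)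
  zero_at_infty' := by
    have hsnd : Tendsto (Prod.mk a) (cocompact B) (comap Prod.snd (cocompact B)) :=
      tendsto_comap_iff.2 tendsto_id
    have hle : comap Prod.snd (cocompact B) ≤ cocompact (A × B) :=
      coprod_cocompact (X := A) (Y := B) ▸ le_sup_right
    exact f.zero_at_infty'.comp (hsnd.mono_right hle)

theorem continuous_zeroAtInftySection (f : C₀(A × B, E)) : Continuous (zeroAtInftySection f) := by
  refine continuous_iff_continuousAt.2 fun a₀ =>
    ZeroAtInftyContinuousMap.tendsto_iff_tendstoUniformly.2 <| Metric.tendstoUniformly_iff.2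
      fun ε hε => ?_
  obtain ⟨K, hK, hKf⟩ := mem_cocompact.1
    (eventually_cocompact_norm_zeroAtInfty_lt f (half_pos hε))
  have hcont : Continuous fun p : A × B => dist (f (a₀, p.2)) (f (p.1, p.2)) :=
    (f.continuous.comp (by fun_prop)).dist (f.continuous.comp (by fun_prop))
  have hnear : ∀ᶠ a in 𝓝 a₀, ∀ b ∈ Prod.snd '' K, dist (f (a₀, b)) (f (a, b)) < ε :=
    (hK.image continuous_snd).eventually_forall_of_forall_eventually fun b _ =>
      hcont.continuousAt.eventually_lt_const (by simpa using hε)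
  filter_upwards [hnear] with a ha b
  by_cases hb : b ∈ Prod.snd '' K
  · exact ha b hb
  · have hsmall (a' : A) : ‖f (a', b)‖ < ε / 2 := hKf fun h => hb ⟨_, h, rfl⟩
    calc dist (f (a₀, b)) (f (a, b)) ≤ ‖f (a₀, b)‖ + ‖f (a, b)‖ := dist_le_norm_add_norm _ _
      _ < ε / 2 + ε / 2 := add_lt_add (hsmall a₀) (hsmall a)
      _ = ε := add_halves ε

theorem tendsto_zeroAtInftySection_cocompact (f : C₀(A × B, E)) :
    Tendsto (zeroAtInftySection f) (cocompact A) (𝓝 0) := by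
  refine ZeroAtInftyContinuousMap.tendsto_iff_tendstoUniformly.2 <| Metric.tendstoUniformly_iff.2
    fun ε hε => ?_
  have hfst : ∀ᶠ p in comap Prod.fst (cocompact A), ‖f p‖ < ε :=
    (eventually_cocompact_norm_zeroAtInfty_lt f hε).filter_mono
      (coprod_cocompact (X := A) (Y := B) ▸ le_sup_left)
  filter_upwards [eventually_comap.1 hfst] with a ha b
  exact (dist_zero_left _).trans_lt (ha (a, b) rfl)

variable (𝕜 : Type*) [NormedField 𝕜] [NormedSpace 𝕜 E]

/-- Currying, as a linear isometry from `C₀(A × B, E)` to `C₀(A, C₀(B, E))`. -/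
noncomputable def zeroAtInftyCurryₗᵢ : C₀(A × B, E) →ₗᵢ[𝕜] C₀(A, C₀(B, E)) where
  toFun f := ⟨⟨zeroAtInftySection f, continuous_zeroAtInftySection f⟩,
    tendsto_zeroAtInftySection_cocompact f⟩
  map_add' _ _ := rfl
  map_smul' _ _ := rfl
  norm_map' f := by
    refine le_antisymm ?_ (norm_zeroAtInfty_le (norm_nonneg _) fun p => ?_)
    · exact norm_zeroAtInfty_le (norm_nonneg f) fun a =>
        norm_zeroAtInfty_le (norm_nonneg f) fun b => norm_zeroAtInfty_apply_le f (a, b)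
    · exact (norm_zeroAtInfty_apply_le (zeroAtInftySection f p.1) p.2).trans
        (norm_zeroAtInfty_apply_le (⟨⟨zeroAtInftySection f, _⟩, _⟩ : C₀(A, C₀(B, E))) p.1)

/-- Composition with a homeomorphism `A ≃ₜ B`, as a linear isometry from `C₀(B, E)` to
`C₀(A, E)`. -/
noncomputable def zeroAtInftyCompHomeomorphₗᵢ (e : A ≃ₜ B) : C₀(B, E) →ₗᵢ[𝕜] C₀(A, E) where
  toLinearMap := ZeroAtInftyContinuousMap.compLinearMap
    ⟨⟨e, e.continuous⟩, e.isClosedEmbedding.tendsto_cocompact⟩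
  norm_map' f := by
    refine le_antisymm
      (norm_zeroAtInfty_le (norm_nonneg f) fun a => norm_zeroAtInfty_apply_le f (e a))
      (norm_zeroAtInfty_le (norm_nonneg _) fun b => ?_)
    obtain ⟨a, rfl⟩ := e.surjective b
    exact norm_zeroAtInfty_apply_le
      (f.comp ⟨⟨e, e.continuous⟩, e.isClosedEmbedding.tendsto_cocompact⟩) a

end Curry

variable {k : ℕ∞} {E : Type w} [NormedAddCommGroup E] [NormedSpace ℝ E]

theorem AdmitsBump.zeroAtInfty_prod (h : AdmitsBump k C₀(A, C₀(B, E))) :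
    AdmitsBump k C₀(A × B, E) :=
  h.of_antilipschitz (zeroAtInftyCurryₗᵢ ℝ).toContinuousLinearMap
    (zeroAtInftyCurryₗᵢ ℝ).antilipschitz

theorem AdmitsBump.zeroAtInfty_congr (h : AdmitsBump k C₀(A, E)) (e : A ≃ₜ B) :
    AdmitsBump k C₀(B, E) :=
  h.of_antilipschitz (zeroAtInftyCompHomeomorphₗᵢ ℝ e).toContinuousLinearMap
    (zeroAtInftyCompHomeomorphₗᵢ ℝ e).antilipschitz

theorem AdmitsBump.zeroAtInfty_of_subsingleton [Subsingleton A] [Nonempty A] (h : AdmitsBump k E) :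
    AdmitsBump k C₀(A, E) := by
  obtain ⟨a⟩ := ‹Nonempty A›
  refine h.of_antilipschitz (zeroAtInftyEvalCLM ℝ a) (K := 1) <|
    AddMonoidHomClass.antilipschitz_of_bound _ fun f => ?_
  rw [NNReal.coe_one, one_mul]
  exact norm_zeroAtInfty_le (norm_nonneg _) fun b => by
    rw [Subsingleton.elim b a, zeroAtInftyEvalCLM_apply]

/-- Prepending a coordinate to a finite tuple, as a homeomorphism. -/
def finConsHomeomorph {n : ℕ} (L : Fin (n + 1) → Type u) [∀ i, TopologicalSpace (L i)] :
    L 0 × ((i : Fin n) → L i.succ) ≃ₜ ((i : Fin (n + 1)) → L i) where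
  toEquiv := Fin.consEquiv L
  continuous_toFun := continuous_fst.finCons continuous_snd
  continuous_invFun :=
    (continuous_apply 0).prodMk (continuous_pi fun i => continuous_apply i.succ)

theorem AdmitsBump.zeroAtInfty_pi (hE : AdmitsBump k E) {n : ℕ} {L : Fin n → Type u}
    [∀ i, TopologicalSpace (L i)]
    (hL : ∀ (i) (F : Type max u w) [NormedAddCommGroup F] [NormedSpace ℝ F],
      AdmitsBump k F → AdmitsBump k C₀(L i, F)) : AdmitsBump k C₀((i : Fin n) → L i, E) := by
  induction n with
  | zero => exact hE.zeroAtInfty_of_subsingleton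
  | succ n ih =>
    have htail : AdmitsBump k C₀((i : Fin n) → L i.succ, E) := ih fun i => hL i.succ
    exact (hL 0 _ htail).zeroAtInfty_prod.zeroAtInfty_congr (finConsHomeomorph L)

end Product

theorem AdmitsBump.zeroAtInfty_of_homeomorph_wellOrder {k : ℕ∞} {E : Type w} [NormedAddCommGroup E]
    [NormedSpace ℝ E] (hE : AdmitsBump k E) {L : Type u} [TopologicalSpace L] {Ω : Type v}
    [LinearOrder Ω] [WellFoundedLT Ω] [TopologicalSpace Ω] [OrderTopology Ω] (e : L ≃ₜ Ω) :
    AdmitsBump k C₀(L, E) :=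
  let _ : SuccOrder Ω := .ofLinearWellFoundedLT Ω
  ((isTalagrandOperator_succDiff k).admitsBump_zeroAtInfty hE).zeroAtInfty_congr e.symm

theorem proposition2_general (k : ℕ∞) (E : Type w) [NormedAddCommGroup E] [NormedSpace ℝ E]
    (hE : AdmitsBump k E) :
    (∀ (L : Type u) [TopologicalSpace L],
      (∃ T : C₀(L, ℝ) → cZero L, IsTalagrandOperator k T) → AdmitsBump k C₀(L, E)) ∧
    (∀ (n : ℕ) (L : Fin n → Type u) [∀ i, TopologicalSpace (L i)],
      (∀ i, ∃ Ω : Ordinal.{v}, Nonempty (L i ≃ₜ Set.Iio Ω)) →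
      AdmitsBump k C₀((i : Fin n) → L i, E)) := by
  refine ⟨fun L _ ⟨T, hT⟩ => hT.admitsBump_zeroAtInfty hE, fun n L _ hL => ?_⟩
  refine hE.zeroAtInfty_pi fun i F _ _ hF => ?_
  obtain ⟨Ω, ⟨e⟩⟩ := hL i
  exact hF.zeroAtInfty_of_homeomorph_wellOrder e

theorem proposition2 (k : ℕ∞) (hk : 1 ≤ k)
    (E : Type w) [NormedAddCommGroup E] [NormedSpace ℝ E] [CompleteSpace E]
    (hE : AdmitsBump k E) :
    (∀ (L : Type u) [TopologicalSpace L] [LocallyCompactSpace L],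
      (∃ T : C₀(L, ℝ) → cZero L, Continuous T ∧
        (∀ f : C₀(L, ℝ), (toEllInfty f, T f) ∈ talagrandSet L ∪ {0}) ∧
        (∀ t : L, ContDiff ℝ k (fun f : C₀(L, ℝ) => (T f).1 t) ∧
          DependsLocallyOnFinitelyManyCoords (fun f : C₀(L, ℝ) => (T f).1 t))) →
      AdmitsBump k C₀(L, E)) ∧
    (∀ (n : ℕ) (L : Fin n → Type u) [∀ i, TopologicalSpace (L i)],
      (∀ i, ∃ Ω : Ordinal.{v}, Nonempty (L i ≃ₜ Set.Iio Ω)) →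
      AdmitsBump k C₀((i : Fin n) → L i, E)) := by
  have h := proposition2_general k E hE
  exact ⟨fun L _ _ ⟨T, hT, hU, hc⟩ => h.1 L ⟨T, hT, hU, fun t => (hc t).1, fun t => (hc t).2⟩, h.2⟩
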